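/- Let $f$ be a function that is holomorphic in a neighbourhood of a point $z_0\in\mathbb C$ with $f(z_0)=z_0$ and $f'(z_0)=0$, and that is not constant near $z_0$. Put $p:=\min\{n\ge 1: f^{(n)}(z_0)\neq 0\}$ (so $p\ge 2$). Let $U$ be an open neighbourhood of $z_0$ on which $f$ is holomorphic with $f(U)\subset U$, let $V$ be an open neighbourhood of $0$ contained in the open unit disc, and let $\varphi:U\to V$ be a conformal map (holomorphic bijection) with $\varphi(f(z))=\varphi(z)^p$ for all $z\in U$ (such $U,V,\varphi$ exist by Böttcher's theorem). For $\delta>0$ with $\{w\in\mathbb C:|w|\le\delta\}\subset V$, put $B_\delta:=\varphi^{-1}(\{w:|w|\le\delta\})$, a compact neighbourhood of $z_0$, and let $\mathcal K(B_\delta)$ be the space of non-empty compact subsets of $B_\delta$ with the Hausdorff distance. Let $H(\mathbb C\setminus\{z_0\})$ be the space of holomorphic functions on $\mathbb C\setminus\{z_0\}$ with the topology of locally uniform convergence. For a compact set $K\subset B_\delta^\circ\setminus\{z_0\}$ (a set which $f$ maps into itself), a function $g\in H(\mathbb C\setminus\{z_0\})$ is called $C(K)$-universal for the composition operator $C_f$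 if $\{g\circ f^n|_K: n=1,2,3,\dots\}$ is dense in the space $C(K)$ of continuous complex-valued functions on $K$ with the uniform norm, where $f^n$ is the $n$-th iterate of $f$. Then, for each $\delta>0$ with $\{w:|w|\le\delta\}\subset V$, comeager many $K\in\mathcal K(B_\delta)$ have the property that $K\subset B_\delta^\circ\setminus\{z_0\}$ and comeager many functions $g\in H(\mathbb C\setminus\{z_0\})$ are $C(K)$-universal for $C_f$. (A property holds for comeager many elements of a space if the set of elements with this property contains a countable intersection of dense open sets.) -/

import Mathlib

open Set Filter Topology TopologicalSpace

/-- `H(Ω)`: the holomorphic functions on `Ω` (an open set in all uses), as a subspace of `C(Ω, ℂ)`.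
The compact-open topology of `C(Ω, ℂ)` is that of locally uniform convergence. -/
abbrev HolFun (Ω : Set ℂ) : Type :=
  {g : C(Ω, ℂ) // ∃ G : ℂ → ℂ, DifferentiableOn ℂ G Ω ∧ ∀ z : Ω, g z = G z}

/-- `𝒦(M)`: the non-empty compact subsets of `M`, with the Hausdorff distance (inherited from
the metric space `NonemptyCompacts ℂ`). -/
abbrev CompactsIn (M : Set ℂ) : Type :=
  {K : NonemptyCompacts ℂ // (K : Set ℂ) ⊆ M}

/-- The functions `g ∘ fⁿ|_M`, `n = 1, 2, 3, …`, as elements of `C(M, ℂ)`. The clause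
`f^[n] z ∈ Ω` says that the composition is defined; it holds automatically
when `M ⊆ D ⊆ Ω` and `f` maps `D` into `D`. -/
def compositionOrbit {Ω : Set ℂ} (f : ℂ → ℂ) (M : Set ℂ) (g : HolFun Ω) : Set C(M, ℂ) :=
  {u | ∃ n : ℕ, 1 ≤ n ∧ ∀ z : M, ∃ h : f^[n] z ∈ Ω, u z = g.1 ⟨f^[n] z, h⟩}

/-- `g ∈ H(Ω)` is `Ω`-`F`-universal for the composition operator `C_f`, where `f` is a self-map
of `D ⊆ Ω`, `M ⊆ D` and `F ⊆ C(M)`. -/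
def IsFUniversal (D Ω : Set ℂ) (f : ℂ → ℂ) (M : Set ℂ) (F : Set C(M, ℂ)) (g : HolFun Ω) : Prop :=
  D ⊆ Ω ∧ MapsTo f D D ∧ M ⊆ D ∧ F ⊆ closure (compositionOrbit f M g)

/-- The order `p = min {n ≥ 1 : f⁽ⁿ⁾(z₀) ≠ 0}`. -/
noncomputable def localOrder (f : ℂ → ℂ) (z₀ : ℂ) : ℕ :=
  sInf {n : ℕ | 1 ≤ n ∧ iteratedDeriv n f z₀ ≠ 0}

/-- `φ` is a conformal (biholomorphic) map from the open neighbourhood `U` of `z₀` onto the open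
neighbourhood `V ⊆ 𝔻` of `0` that conjugates `f|_U : U → U` to `w ↦ w ^ p` on `V`. -/
structure IsBottcherMap (f : ℂ → ℂ) (z₀ : ℂ) (U V : Set ℂ) (φ : ℂ → ℂ) : Prop where
  isOpen_source : IsOpen U
  mem_source : z₀ ∈ U
  isOpen_target : IsOpen V
  zero_mem_target : (0 : ℂ) ∈ V
  target_subset : V ⊆ Metric.ball 0 1
  differentiableOn : DifferentiableOn ℂ φ U
  bijOn : BijOn φ U V
  mapsTo : MapsTo f U U
  conj : ∀ z ∈ U, φ (f z) = φ z ^ localOrder f z₀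

/-- `B_δ = φ⁻¹(U_δ[0])`, the preimage being taken under `φ : U → V`. -/
def bottcherBall (U : Set ℂ) (φ : ℂ → ℂ) (δ : ℝ) : Set ℂ :=
  U ∩ φ ⁻¹' Metric.closedBall 0 δ

/-! In the Böttcher coordinate `f` is `w ↦ w ^ p` with `p ≥ 2`, so orbits in `U` tend to `z₀`, while
points with different `‖φ z‖` never collide under iteration. Finite sets `K` avoiding `z₀` whose
points have distinct moduli are dense in the compact subsets of `B_δ`. For such `K` and a large `n`,
the set `fⁿ(K)` lies closer to `z₀` than a given compact subset of the punctured plane. A rational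
function with its only pole at `z₀` can then correct a given `g` on `fⁿ(K)` to any prescribed values
and stay small on that compact set (`exists_interpolation_small`,
`HolFun.exists_mem_forall_iterate_eq`). Baire category transfers this from finite sets to generic
compact sets: approximation within an error is an open condition in `K` and in `g`, and countably
many basic open sets, targets and errors suffice (`residual_isFUniversal_of_transitive`). -/

/-! ### Interpolation and approximation by finite sets -/

/-- Rational interpolation with a single pole `z₀`, small on a compact set farther from `z₀` than
the nodes. -/
lemma exists_interpolation_small {z₀ : ℂ} {L : Set ℂ} (hL : IsCompact L) (F : Finset ℂ)
    (hF : ∀ a ∈ F, a ≠ z₀) (hFL : ∀ a ∈ F, ∀ z ∈ L, dist a z₀ < dist z z₀) (c : ℂ → ℂ)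
    {ε : ℝ} (hε : 0 < ε) :
    ∃ q : ℂ → ℂ, DifferentiableOn ℂ q {z₀}ᶜ ∧ (∀ a ∈ F, q a = c a) ∧ ∀ z ∈ L, ‖q z‖ < ε := by
  have hz (z : ℂ) (hzL : z ∈ ({z₀}ᶜ : Set ℂ)) : z - z₀ ≠ 0 := sub_ne_zero.mpr hzL
  have key (a : ℂ) (ha : a ∈ F) (η : ℝ) (hη : 0 < η) :
      ∃ e : ℂ → ℂ, DifferentiableOn ℂ e {z₀}ᶜ ∧ e a = c a ∧ (∀ b ∈ F, b ≠ a → e b = 0) ∧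
        ∀ z ∈ L, ‖e z‖ < η := by
    have haz : a - z₀ ≠ 0 := hz a (hF a ha)
    set P : ℂ → ℂ := fun z => c a * ∏ b ∈ F.erase a, (z - b) / (a - b) with hP
    have hPd : Differentiable ℂ P := by
      rw [hP]; fun_prop
    obtain ⟨M, hM⟩ := hL.exists_bound_of_continuousOn hPd.continuous.continuousOn
    obtain ⟨ρ, hρ0, hρ1, hρ⟩ : ∃ ρ : ℝ, 0 ≤ ρ ∧ ρ < 1 ∧ ∀ z ∈ L, ‖(a - z₀) / (z - z₀)‖ ≤ ρ := by
      rcases L.eq_empty_or_nonempty with rfl | hne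
      · exact ⟨0, le_rfl, one_pos, by simp⟩
      have hcont : ContinuousOn (fun z => ‖(a - z₀) / (z - z₀)‖) L := by
        refine (ContinuousOn.div (by fun_prop) (by fun_prop) fun z hzL => ?_).norm
        have := hFL a ha z hzL
        exact sub_ne_zero.mpr (dist_pos.mp (dist_nonneg.trans_lt this))
      obtain ⟨w, hw, hmax⟩ := hL.exists_isMaxOn hne hcont
      refine ⟨_, norm_nonneg _, ?_, fun z hzL => hmax hzL⟩
      have := hFL a ha w hw
      rw [norm_div, ← dist_eq_norm, ← dist_eq_norm]
      exact (div_lt_one (dist_nonneg.trans_lt this)).mpr this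
    obtain ⟨N, hN⟩ : ∃ N : ℕ, (|M| + 1) * ρ ^ N < η := by
      have := (tendsto_pow_atTop_nhds_zero_of_lt_one hρ0 hρ1).const_mul (|M| + 1)
      rw [mul_zero] at this
      exact (this.eventually_lt_const hη).exists
    -- The Lagrange polynomial gives the values at the nodes. The extra factor is 1 at `a` and
    -- uniformly small on `L` for large `N`, since `a` is nearer to `z₀`.
    refine ⟨fun z => P z * ((a - z₀) / (z - z₀)) ^ N, ?_, ?_, ?_, ?_⟩
    · refine hPd.differentiableOn.mul (DifferentiableOn.pow ?_ N)
      exact DifferentiableOn.div (by fun_prop) (by fun_prop) hz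
    · have : ∏ b ∈ F.erase a, (a - b) / (a - b) = 1 :=
        Finset.prod_eq_one fun b hb =>
          div_self (sub_ne_zero.mpr (Finset.ne_of_mem_erase hb).symm)
      simp only [hP, this, div_self haz, one_pow, mul_one]
    · intro b hb hba
      have : ∏ d ∈ F.erase a, (b - d) / (a - d) = 0 :=
        Finset.prod_eq_zero (Finset.mem_erase.mpr ⟨hba, hb⟩) (by simp)
      simp only [hP, this, mul_zero, zero_mul]
    · intro z hzL
      rw [norm_mul, norm_pow]
      refine lt_of_le_of_lt ?_ hN
      gcongr
      · exact (hM z hzL).trans ((le_abs_self M).trans (by linarith))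
      · exact hρ z hzL
  have hη : 0 < ε / (F.card + 1) := by positivity
  choose! e hed hea heb heL using fun a ha => key a ha _ hη
  refine ⟨fun z => ∑ a ∈ F, e a z, DifferentiableOn.fun_sum fun a ha => hed a ha, ?_, ?_⟩
  · intro a ha
    beta_reduce
    rw [Finset.sum_eq_single_of_mem a ha fun b hb hba => heb b hb a ha hba.symm, hea a ha]
  · intro z hzL
    calc ‖∑ a ∈ F, e a z‖ ≤ ∑ a ∈ F, ε / (F.card + 1) :=
          norm_sum_le_of_le _ fun a ha => (heL a ha z hzL).le
      _ = ε * (F.card / (F.card + 1)) := by rw [Finset.sum_const, nsmul_eq_mul]; ring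
      _ < ε := mul_lt_of_lt_one_right hε ((div_lt_one (by positivity)).mpr (by linarith))

/-- A finite family of infinite sets has a system of distinct representatives. -/
lemma exists_injOn_of_infinite {α β : Type*} [Nonempty β] (t : Finset α) (S : α → Set β)
    (hS : ∀ x ∈ t, (S x).Infinite) : ∃ y : α → β, (∀ x ∈ t, y x ∈ S x) ∧ InjOn y t := by
  classical
  induction t using Finset.induction_on with
  | empty => exact ⟨fun _ => Classical.arbitrary β, by simp⟩
  | insert a t ha ih =>
    obtain ⟨y, hy, hinj⟩ := ih fun x hx => hS x (Finset.mem_insert_of_mem hx)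
    obtain ⟨b, hb, hbt⟩ := ((hS a (Finset.mem_insert_self a t)).sdiff
      (t.image y).finite_toSet).nonempty
    have hupd (x) (hx : x ∈ t) : Function.update y a b x = y x :=
      Function.update_of_ne (ne_of_mem_of_not_mem hx ha) _ _
    refine ⟨Function.update y a b, ?_, ?_⟩
    · intro x hx
      rcases Finset.mem_insert.mp hx with rfl | hx
      · simpa using hb
      · rw [hupd x hx]; exact hy x hx
    · rw [Finset.coe_insert, injOn_insert (by simpa using ha)]
      refine ⟨hinj.congr fun x hx => (hupd x hx).symm, ?_⟩
      rintro ⟨x, hx, hxb⟩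
      rw [hupd x hx, Function.update_self] at hxb
      exact hbt (by simpa using ⟨x, hx, hxb⟩)

lemma HolFun.exists_forall_dist_lt {Ω : Set ℂ} {O : Set (HolFun Ω)} (hO : IsOpen O)
    {h : HolFun Ω} (hh : h ∈ O) :
    ∃ L : Set Ω, IsCompact L ∧ ∃ η > 0, ∀ g : HolFun Ω,
      (∀ z ∈ L, dist (h.1 z) (g.1 z) < η) → g ∈ O := by
  obtain ⟨O', hO', rfl⟩ := isOpen_induced_iff.mp hO
  have hb := nhds_basis_uniformity
    (Metric.uniformity_basis_dist.compactConvergenceUniformity (α := Ω) (β := ℂ)) (x := h.1)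
  obtain ⟨⟨L, η⟩, ⟨hL, hη⟩, hsub⟩ := hb.mem_iff.mp (hO'.mem_nhds hh)
  refine ⟨L, hL, η, hη, fun g hg => hsub fun z hz => ?_⟩
  have := hg z hz
  rw [dist_comm] at this
  exact this


/-- A non-empty compact set is approximated by finite sets obtained by moving the points of a
finite net, subject to prescribing infinitely many admissible positions `S x` for each point `x`
and an invariant `m` that has to separate the points. -/
lemma exists_finite_approx {β : Type*} [Nonempty β] {A : Set ℂ} (m : ℂ → β)
    {K₀ : NonemptyCompacts ℂ} {ε : ℝ} (hε : 0 < ε)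
    (hA : ∀ x ∈ (K₀ : Set ℂ), (m '' (A ∩ Metric.ball x (ε / 2))).Infinite) :
    ∃ K : NonemptyCompacts ℂ, (K : Set ℂ).Finite ∧ (K : Set ℂ) ⊆ A ∧ InjOn m K ∧
      dist K K₀ ≤ ε := by
  classical
  obtain ⟨t, htK, ht, hcov⟩ := K₀.isCompact.finite_cover_balls (half_pos hε)
  lift t to Finset ℂ using ht
  obtain ⟨w, hw, hinj⟩ := exists_injOn_of_infinite t _ fun x hx => hA x (htK hx)
  choose! y hy hym using hw
  have hyd (x) (hx : x ∈ t) : dist (y x) x < ε / 2 := (hy x hx).2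
  have hne : (y '' (t : Set ℂ)).Nonempty := by
    obtain ⟨x, hx⟩ := K₀.nonempty
    obtain ⟨a, ha, -⟩ := mem_iUnion₂.mp (hcov hx)
    exact ⟨_, mem_image_of_mem y ha⟩
  have hfin : (y '' (t : Set ℂ)).Finite := t.finite_toSet.image y
  refine ⟨⟨⟨y '' t, hfin.isCompact⟩, hne⟩, hfin, ?_, ?_, ?_⟩
  · rintro _ ⟨x, hx, rfl⟩
    exact (hy x hx).1
  · rintro _ ⟨x, hx, rfl⟩ _ ⟨x', hx', rfl⟩ h
    rw [hym x hx, hym x' hx'] at h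
    rw [hinj hx hx' h]
  · rw [Metric.NonemptyCompacts.dist_eq]
    refine Metric.hausdorffDist_le_of_mem_dist hε.le ?_ ?_
    · rintro _ ⟨x, hx, rfl⟩
      exact ⟨x, htK hx, (hyd x hx).le.trans (half_le_self hε.le)⟩
    · intro x hx
      obtain ⟨a, ha, hxa⟩ := mem_iUnion₂.mp (hcov hx)
      refine ⟨y a, mem_image_of_mem y ha, (dist_triangle x a (y a)).trans ?_⟩
      have := hyd a ha
      rw [dist_comm] at this
      linarith [Metric.mem_ball.mp hxa]

/-! ### From transitivity to generic universality -/

section Transitivity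

variable {Ω A : Set ℂ} {f : ℂ → ℂ}

/-- The iterate `fⁿ` of a continuous self-map of `A ⊆ Ω`, as a continuous map `A → Ω`. -/
def iterateMap (hAΩ : A ⊆ Ω) (hf : MapsTo f A A) (hfc : ContinuousOn f A) (n : ℕ) : C(A, Ω) where
  toFun z := ⟨f^[n] z, hAΩ (hf.iterate n z.2)⟩
  continuous_toFun :=
    Continuous.subtype_mk (continuousOn_iff_continuous_domRestrict.mp (hfc.iterate hf n)) _

/-- The points `z ∈ A` for which `g (fⁿ z)` is within `ε` of `u z`. -/
def approxSet (hAΩ : A ⊆ Ω) (hf : MapsTo f A A) (hfc : ContinuousOn f A) (n : ℕ) (g : HolFun Ω)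
    (u : C(ℂ, ℂ)) (ε : ℝ) : Set ℂ :=
  Subtype.val '' {z : A | dist (g.1 (iterateMap hAΩ hf hfc n z)) (u z) < ε}

lemma isOpen_approxSet (hA : IsOpen A) (hAΩ : A ⊆ Ω) (hf : MapsTo f A A) (hfc : ContinuousOn f A)
    (n : ℕ) (g : HolFun Ω) (u : C(ℂ, ℂ)) (ε : ℝ) : IsOpen (approxSet hAΩ hf hfc n g u ε) :=
  hA.isOpenMap_subtype_val _ <| isOpen_lt (by fun_prop) continuous_const

lemma isOpen_setOf_subset_approxSet (hAΩ : A ⊆ Ω) (hf : MapsTo f A A)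
    (hfc : ContinuousOn f A) (n : ℕ) {K : Set ℂ} (hK : IsCompact K) (hKA : K ⊆ A) (u : C(ℂ, ℂ))
    (ε : ℝ) : IsOpen {g : HolFun Ω | K ⊆ approxSet hAΩ hf hfc n g u ε} := by
  have : CompactSpace K := isCompact_iff_compactSpace.mp hK
  rcases le_or_gt ε 0 with hε | hε
  · rcases K.eq_empty_or_nonempty with rfl | ⟨x, hx⟩
    · simp
    · convert isOpen_empty
      refine eq_empty_of_forall_notMem fun g hg => ?_
      obtain ⟨z, hz, -⟩ := hg hx
      exact (dist_nonneg.trans_lt hz).not_ge hε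
  let T : C(K, Ω) := (iterateMap hAΩ hf hfc n).comp ⟨inclusion hKA, continuous_inclusion hKA⟩
  have hT : Continuous fun g : HolFun Ω => g.1.comp T :=
    (ContinuousMap.continuous_precomp T).comp continuous_subtype_val
  convert (Metric.isOpen_ball (x := u.restrict K) (ε := ε)).preimage hT
  ext g
  rw [mem_preimage, Metric.mem_ball, ContinuousMap.dist_lt_iff hε]
  constructor
  · intro h z
    obtain ⟨z', hz', hzz'⟩ := h z.2
    obtain rfl : z' = inclusion hKA z := Subtype.ext hzz'
    exact hz'
  · exact fun h z hz => ⟨⟨z, hKA hz⟩, h ⟨z, hz⟩, rfl⟩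

/-- Universality is generic if the orbit maps are topologically transitive in the pair
(compact set, holomorphic function). -/
theorem residual_isFUniversal_of_transitive {B : Set ℂ} (hΩ : IsOpen Ω) (hA : IsOpen A)
    (hAΩ : A ⊆ Ω) (hf : MapsTo f A A) (hfc : ContinuousOn f A)
    (htrans : ∀ (K₀ : CompactsIn B) (ε : ℝ), 0 < ε → ∀ O : Set (HolFun Ω), IsOpen O →
      O.Nonempty → ∀ u : C(ℂ, ℂ), ∃ K : CompactsIn B, dist K K₀ ≤ ε ∧ ∃ n, 1 ≤ n ∧ ∃ g ∈ O,
        (K.1 : Set ℂ) ⊆ A ∧ ∀ z ∈ (K.1 : Set ℂ), ∀ h : f^[n] z ∈ Ω, g.1 ⟨f^[n] z, h⟩ = u z) :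
    ∀ᶠ K in residual (CompactsIn B), ∀ᶠ g in residual (HolFun Ω),
      IsFUniversal A Ω f (K.1 : Set ℂ) (univ : Set C((K.1 : Set ℂ), ℂ)) g := by
  have : LocallyCompactSpace Ω := hΩ.locallyCompactSpace
  have : SecondCountableTopology C(Ω, ℂ) := inferInstance
  have : SecondCountableTopology (HolFun Ω) := Subtype.secondCountableTopology _
  have : Nonempty (HolFun Ω) := ⟨⟨0, 0, differentiableOn_const 0, fun _ => rfl⟩⟩
  let E (n : ℕ) (g : HolFun Ω) (u : C(ℂ, ℂ)) (k : ℕ) : Set ℂ :=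
    approxSet hAΩ hf hfc n g u (1 / (k + 1))
  let u : ℕ → C(ℂ, ℂ) := denseSeq C(ℂ, ℂ)
  let 𝒪 : Set (Set (HolFun Ω)) := countableBasis (HolFun Ω)
  -- The condition on `K` alone is that every basic open set contains some good `g`; this is exactly
  -- the density needed afterwards in the space of functions.
  have hres : ∀ᶠ K in residual (CompactsIn B), ∀ O ∈ 𝒪, ∀ m k : ℕ,
      ∃ n, 1 ≤ n ∧ ∃ g ∈ O, (K.1 : Set ℂ) ⊆ E n g (u m) k := by
    refine (eventually_countable_ball (countable_countableBasis _)).mpr fun O hO => ?_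
    refine eventually_countable_forall.mpr fun m => eventually_countable_forall.mpr fun k => ?_
    refine residual_of_dense_open ?_ ?_
    · have : {K : CompactsIn B | ∃ n, 1 ≤ n ∧ ∃ g ∈ O, (K.1 : Set ℂ) ⊆ E n g (u m) k} =
          ⋃ n ∈ {n : ℕ | 1 ≤ n}, ⋃ g ∈ O, {K : CompactsIn B | (K.1 : Set ℂ) ⊆ E n g (u m) k} := by
        ext K; simp
      change IsOpen {K : CompactsIn B | ∃ n, 1 ≤ n ∧ ∃ g ∈ O, (K.1 : Set ℂ) ⊆ E n g (u m) k}
      rw [this]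
      refine isOpen_biUnion fun n _ => isOpen_biUnion fun g _ => ?_
      exact (NonemptyCompacts.isOpen_subsets_of_isOpen
        (isOpen_approxSet hA hAΩ hf hfc n g (u m) _)).preimage continuous_subtype_val
    · refine Metric.dense_iff.mpr fun K₀ r hr => ?_
      obtain ⟨K, hK, n, hn, g, hg, hKA, hgK⟩ := htrans K₀ (r / 2) (half_pos hr) O
        (isOpen_of_mem_countableBasis hO) (nonempty_of_mem_countableBasis hO) (u m)
      refine ⟨K, hK.trans_lt (half_lt_self hr), n, hn, g, hg, fun z hz => ?_⟩
      refine ⟨⟨z, hKA hz⟩, ?_, rfl⟩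
      have : g.1 (iterateMap hAΩ hf hfc n ⟨z, hKA hz⟩) = u m z := hgK z hz _
      rw [mem_ofPred_eq, this, dist_self]
      positivity
  filter_upwards [hres] with K hK
  -- A single instance suffices, because each approximation set lies in `A`.
  have hKA : (K.1 : Set ℂ) ⊆ A := by
    obtain ⟨O, hO, -⟩ := mem_sUnion.mp
      ((isBasis_countableBasis (HolFun Ω)).sUnion_eq.symm ▸ mem_univ (Classical.arbitrary _))
    obtain ⟨n, -, g, -, h⟩ := hK O hO 0 0
    exact h.trans (Subtype.coe_image_subset _ _)
  have hgen : ∀ᶠ g in residual (HolFun Ω), ∀ m k : ℕ, ∃ n, 1 ≤ n ∧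
      (K.1 : Set ℂ) ⊆ E n g (u m) k := by
    refine eventually_countable_forall.mpr fun m => eventually_countable_forall.mpr fun k => ?_
    refine residual_of_dense_open ?_ ?_
    · have : {g : HolFun Ω | ∃ n, 1 ≤ n ∧ (K.1 : Set ℂ) ⊆ E n g (u m) k} =
          ⋃ n ∈ {n : ℕ | 1 ≤ n}, {g : HolFun Ω | (K.1 : Set ℂ) ⊆ E n g (u m) k} := by
        ext g; simp
      change IsOpen {g : HolFun Ω | ∃ n, 1 ≤ n ∧ (K.1 : Set ℂ) ⊆ E n g (u m) k}
      rw [this]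
      exact isOpen_biUnion fun n _ =>
        isOpen_setOf_subset_approxSet hAΩ hf hfc n K.1.isCompact hKA (u m) _
    · refine (isBasis_countableBasis (HolFun Ω)).dense_iff.mpr fun O hO _ => ?_
      obtain ⟨n, hn, g, hg, h⟩ := hK O hO m k
      exact ⟨g, hg, n, hn, h⟩
  filter_upwards [hgen] with g hg
  refine ⟨hAΩ, hf, hKA, fun v _ => ?_⟩
  have : CompactSpace (K.1 : Set ℂ) := isCompact_iff_compactSpace.mp K.1.isCompact
  refine Metric.mem_closure_iff.mpr fun ε hε => ?_
  -- By Tietze extension, one dense sequence in `C(ℂ, ℂ)` supplies the targets for all `K` at once.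
  obtain ⟨v', hv'⟩ := v.exists_restrict_eq K.1.isCompact.isClosed
  obtain ⟨m, hm⟩ : ∃ m, dist v ((u m).restrict K.1) < ε / 2 := by
    obtain ⟨m, hm⟩ := (denseRange_denseSeq C(ℂ, ℂ)).exists_mem_open
      ((Metric.isOpen_ball (x := v) (ε := ε / 2)).preimage
        (ContinuousMap.continuous_restrict (K.1 : Set ℂ))) ⟨v', by simp [hv', hε]⟩
    exact ⟨m, by rw [dist_comm]; exact hm⟩
  obtain ⟨k, hk⟩ := exists_nat_one_div_lt (half_pos hε)
  obtain ⟨n, hn, hn'⟩ := hg m k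
  let T : C((K.1 : Set ℂ), Ω) :=
    (iterateMap hAΩ hf hfc n).comp ⟨inclusion hKA, continuous_inclusion hKA⟩
  refine ⟨g.1.comp T, ⟨n, hn, fun z => ⟨(T z).2, rfl⟩⟩, ?_⟩
  have hclose : dist ((u m).restrict K.1) (g.1.comp T) < ε / 2 := by
    refine (ContinuousMap.dist_lt_iff (half_pos hε)).mpr fun z => ?_
    obtain ⟨z', hz', hzz'⟩ := hn' z.2
    obtain rfl : z' = inclusion hKA z := Subtype.ext hzz'
    rw [dist_comm]
    exact lt_trans hz' hk
  linarith [dist_triangle v ((u m).restrict K.1) (g.1.comp T)]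

end Transitivity

/-! ### Dynamics in the Böttcher coordinate -/

namespace IsBottcherMap

variable {f φ : ℂ → ℂ} {z₀ : ℂ} {U V : Set ℂ} {δ : ℝ}

lemma norm_lt_one (hφ : IsBottcherMap f z₀ U V φ) {z : ℂ} (hz : z ∈ U) : ‖φ z‖ < 1 := by
  simpa using hφ.target_subset (hφ.bijOn.mapsTo hz)

lemma two_le_localOrder (hφ : IsBottcherMap f z₀ U V φ) (hsuper : deriv f z₀ = 0) :
    2 ≤ localOrder f z₀ := by
  -- Order 0, the default infimum of the empty set, would give `φ (f z₀) = 1`, outside the unit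
  -- disc.
  have h0 : localOrder f z₀ ≠ 0 := fun h => by
    have := hφ.norm_lt_one (hφ.mapsTo hφ.mem_source)
    simp [hφ.conj z₀ hφ.mem_source, h] at this
  have h1 : localOrder f z₀ ≠ 1 := fun h => by
    have hne : {n : ℕ | 1 ≤ n ∧ iteratedDeriv n f z₀ ≠ 0}.Nonempty :=
      Nat.nonempty_of_pos_sInf (Nat.pos_of_ne_zero h0)
    have := (Nat.sInf_mem hne).2
    change iteratedDeriv (localOrder f z₀) f z₀ ≠ 0 at this
    rw [h, iteratedDeriv_one] at this
    exact this hsuper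
  omega

lemma apply_center (hφ : IsBottcherMap f z₀ U V φ) (hfix : f z₀ = z₀) (hsuper : deriv f z₀ = 0) :
    φ z₀ = 0 := by
  by_contra h
  have hc : ‖φ z₀‖ = ‖φ z₀‖ ^ localOrder f z₀ := by
    rw [← norm_pow, ← hφ.conj z₀ hφ.mem_source, hfix]
  have := pow_lt_self_of_lt_one₀ (norm_pos_iff.mpr h) (hφ.norm_lt_one hφ.mem_source)
    (hφ.two_le_localOrder hsuper)
  exact this.ne' hc

lemma apply_eq_zero_iff (hφ : IsBottcherMap f z₀ U V φ) (hfix : f z₀ = z₀)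
    (hsuper : deriv f z₀ = 0) {z : ℂ} (hz : z ∈ U) : φ z = 0 ↔ z = z₀ := by
  rw [← hφ.apply_center hfix hsuper]
  exact hφ.bijOn.injOn.eq_iff hz hφ.mem_source

lemma apply_iterate (hφ : IsBottcherMap f z₀ U V φ) {z : ℂ} (hz : z ∈ U) (n : ℕ) :
    φ (f^[n] z) = φ z ^ localOrder f z₀ ^ n := by
  induction n with
  | zero => simp
  | succ n ih =>
    rw [Function.iterate_succ_apply', hφ.conj _ (hφ.mapsTo.iterate n hz), ih, ← pow_mul, pow_succ]

/-- Open mapping theorem: local constancy would contradict injectivity of `φ`, as `z` is not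
isolated. -/
lemma nhds_le_map (hφ : IsBottcherMap f z₀ U V φ) {z : ℂ} (hz : z ∈ U) :
    𝓝 (φ z) ≤ map φ (𝓝 z) := by
  have hU := hφ.isOpen_source.mem_nhds hz
  refine (hφ.differentiableOn.analyticAt hU).eventually_constant_or_nhds_le_map_nhds.resolve_left
    fun h => ?_
  have hsingle : ∀ᶠ w in 𝓝 z, w = z := by
    filter_upwards [h, hU] with w hw hwU using hφ.bijOn.injOn hwU hz hw
  obtain ⟨w, hw, hwz⟩ := (hsingle.filter_mono nhdsWithin_le_nhds |>.and
    (self_mem_nhdsWithin : {z}ᶜ ∈ 𝓝[≠] z)).exists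
  exact hwz hw

/-- The powers `φ z ^ p ^ n` tend to 0, and convergence pulls back to `z₀` because `φ` is open at
`z₀` and injective. -/
lemma tendsto_iterate (hφ : IsBottcherMap f z₀ U V φ) (hfix : f z₀ = z₀)
    (hsuper : deriv f z₀ = 0) {z : ℂ} (hz : z ∈ U) :
    Tendsto (fun n => f^[n] z) atTop (𝓝 z₀) := by
  intro N hN
  have himg : φ '' (N ∩ U) ∈ 𝓝 (0 : ℂ) := by
    rw [← hφ.apply_center hfix hsuper]
    exact hφ.nhds_le_map hφ.mem_source
      (image_mem_map (inter_mem hN (hφ.isOpen_source.mem_nhds hφ.mem_source)))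
  have hlim : Tendsto (fun n => φ (f^[n] z)) atTop (𝓝 0) := by
    simp_rw [hφ.apply_iterate hz]
    exact (tendsto_pow_atTop_nhds_zero_of_norm_lt_one (hφ.norm_lt_one hz)).comp
      (tendsto_pow_atTop_atTop_of_one_lt (hφ.two_le_localOrder hsuper))
  rw [mem_map]
  filter_upwards [hlim.eventually_mem himg] with n hn
  obtain ⟨w, ⟨hwN, hwU⟩, hw⟩ := hn
  rwa [mem_preimage, ← hφ.bijOn.injOn hwU (hφ.mapsTo.iterate n hz) hw]

/-- Taking the power `p ^ n` may identify arguments, but it is injective on moduli. -/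
lemma iterate_inj_of_norm (hφ : IsBottcherMap f z₀ U V φ) (hsuper : deriv f z₀ = 0)
    {K : Set ℂ} (hK : K ⊆ U) (hinj : InjOn (fun z => ‖φ z‖) K) (n : ℕ) :
    InjOn (f^[n]) K := by
  intro z hz w hw h
  refine hinj hz hw ?_
  have hp : localOrder f z₀ ^ n ≠ 0 :=
    pow_ne_zero _ (by have := hφ.two_le_localOrder hsuper; omega)
  have h' := congrArg (fun z => ‖φ z‖) h
  simp only [hφ.apply_iterate (hK hz), hφ.apply_iterate (hK hw), norm_pow] at h'
  exact (pow_left_inj₀ (norm_nonneg _) (norm_nonneg _) hp).mp h'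

lemma mem_interior_bottcherBall (hφ : IsBottcherMap f z₀ U V φ) {z : ℂ} (hz : z ∈ U)
    (hzδ : ‖φ z‖ < δ) : z ∈ interior (bottcherBall U φ δ) := by
  rw [mem_interior_iff_mem_nhds]
  have hc := (hφ.differentiableOn.continuousOn.continuousAt (hφ.isOpen_source.mem_nhds hz)).norm
  filter_upwards [hφ.isOpen_source.mem_nhds hz, hc.eventually_lt_const hzδ] with w hw hwδ
  exact ⟨hw, by simpa using hwδ.le⟩

/-- On the punctured set `f` strictly lowers `‖φ‖`, so images satisfy `‖φ‖ < δ` and are interior. -/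
lemma mapsTo_interior (hφ : IsBottcherMap f z₀ U V φ) (hfix : f z₀ = z₀)
    (hsuper : deriv f z₀ = 0) :
    MapsTo f (interior (bottcherBall U φ δ) \ {z₀}) (interior (bottcherBall U φ δ) \ {z₀}) := by
  rintro z ⟨hz, hz0⟩
  obtain ⟨hzU, hzδ⟩ := interior_subset hz
  have hpos : φ z ≠ 0 := (hφ.apply_eq_zero_iff hfix hsuper hzU).not.mpr hz0
  have hp := hφ.two_le_localOrder hsuper
  refine ⟨hφ.mem_interior_bottcherBall (hφ.mapsTo hzU) ?_, fun h => ?_⟩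
  · rw [hφ.conj z hzU, norm_pow]
    exact (pow_lt_self_of_lt_one₀ (norm_pos_iff.mpr hpos) (hφ.norm_lt_one hzU) hp).trans_le
      (by simpa using hzδ)
  · have := (hφ.apply_eq_zero_iff hfix hsuper (hφ.mapsTo hzU)).mpr h
    rw [hφ.conj z hzU] at this
    exact hpos (eq_zero_of_pow_eq_zero this)

/-- Every point of `B_δ` is approached by points of the punctured interior with infinitely many
different values of `‖φ‖`. -/
lemma infinite_norm_image (hφ : IsBottcherMap f z₀ U V φ) (hfix : f z₀ = z₀)
    (hsuper : deriv f z₀ = 0) (hδ : 0 < δ) {x : ℂ} (hx : x ∈ bottcherBall U φ δ) {ε : ℝ}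
    (hε : 0 < ε) :
    ((fun z => ‖φ z‖) '' ((interior (bottcherBall U φ δ) \ {z₀}) ∩ Metric.ball x ε)).Infinite := by
  obtain ⟨hxU, hxδ⟩ := hx
  replace hxδ : ‖φ x‖ ≤ δ := by simpa using hxδ
  have himg : φ '' (Metric.ball x ε ∩ U) ∈ 𝓝 (φ x) := hφ.nhds_le_map hxU
    (image_mem_map (inter_mem (Metric.ball_mem_nhds x hε) (hφ.isOpen_source.mem_nhds hxU)))
  obtain ⟨r, hr, hball⟩ := Metric.mem_nhds_iff.mp himg
  -- Small positive reals serve at the centre. Elsewhere `φ x` is scaled towards 0, since `‖φ x‖`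
  -- may equal `δ`.
  obtain ⟨a, b, hab, hI⟩ : ∃ a b : ℝ, a < b ∧ ∀ t ∈ Ioo a b,
      ∃ w ∈ Metric.ball (φ x) r, ‖w‖ = t ∧ 0 < t ∧ t < δ := by
    rcases eq_or_ne (φ x) 0 with h0 | h0
    · refine ⟨0, min r δ, lt_min hr hδ, fun t ht => ⟨t, ?_, ?_, ht.1,
        ht.2.trans_le (min_le_right _ _)⟩⟩
      · simpa [h0, abs_of_pos ht.1] using ht.2.trans_le (min_le_left _ _)
      · simp [abs_of_pos ht.1]
    · have hn : 0 < ‖φ x‖ := norm_pos_iff.mpr h0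
      refine ⟨max 0 (‖φ x‖ - r), ‖φ x‖, max_lt hn (by linarith), fun t ht => ?_⟩
      have ht0 : 0 < t := (le_max_left _ _).trans_lt ht.1
      have htr : ‖φ x‖ - r < t := (le_max_right _ _).trans_lt ht.1
      refine ⟨((t / ‖φ x‖ : ℝ) : ℂ) * φ x, ?_, ?_, ht0, ht.2.trans_le hxδ⟩
      · have : ((t / ‖φ x‖ : ℝ) : ℂ) * φ x - φ x = ((t / ‖φ x‖ - 1 : ℝ) : ℂ) * φ x := by
          push_cast; ring
        have hneg : t / ‖φ x‖ - 1 ≤ 0 := by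
          rw [sub_nonpos, div_le_one hn]; exact ht.2.le
        rw [Metric.mem_ball, dist_eq_norm, this, norm_mul, Complex.norm_real, Real.norm_eq_abs,
          abs_of_nonpos hneg, neg_mul, sub_mul, div_mul_cancel₀ _ hn.ne']
        linarith
      · rw [norm_mul, Complex.norm_real, Real.norm_eq_abs, abs_of_pos (div_pos ht0 hn),
          div_mul_cancel₀ _ hn.ne']
  refine (Ioo_infinite hab).mono fun t ht => ?_
  obtain ⟨w, hw, hwt, ht0, htδ⟩ := hI t ht
  obtain ⟨y, ⟨hyx, hyU⟩, rfl⟩ := hball hw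
  refine ⟨y, ⟨⟨hφ.mem_interior_bottcherBall hyU (hwt.trans_lt htδ), ?_⟩, hyx⟩, hwt⟩
  refine (hφ.apply_eq_zero_iff hfix hsuper hyU).not.mp (norm_pos_iff.mp ?_)
  rwa [hwt]

end IsBottcherMap

/-! ### Prescribing values along orbits, and the conclusion -/

/-- If all orbits of a finite set tend to `z₀` and the iterates are injective on it, then some
iterate carries any prescribed values on the set, within any open set of holomorphic functions. -/
lemma HolFun.exists_mem_forall_iterate_eq {f : ℂ → ℂ} {z₀ : ℂ} {K : Set ℂ} (hK : K.Finite)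
    (hlim : ∀ z ∈ K, Tendsto (fun n => f^[n] z) atTop (𝓝 z₀))
    (hne : ∀ z ∈ K, ∀ n, f^[n] z ≠ z₀) (hinj : ∀ n, InjOn (f^[n]) K)
    {O : Set (HolFun ({z₀}ᶜ : Set ℂ))} (hO : IsOpen O) (hOne : O.Nonempty) (u : ℂ → ℂ) :
    ∃ n, 1 ≤ n ∧ ∃ g ∈ O, ∀ z ∈ K, ∀ h : f^[n] z ∈ ({z₀}ᶜ : Set ℂ), g.1 ⟨f^[n] z, h⟩ = u z := by
  classical
  obtain ⟨g₀, hg₀⟩ := hOne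
  obtain ⟨G, hG, hgG⟩ := g₀.2
  obtain ⟨L, hL, η, hη, hLO⟩ := HolFun.exists_forall_dist_lt hO hg₀
  have hL' : IsCompact (Subtype.val '' L : Set ℂ) := hL.image continuous_subtype_val
  have hz₀ : (Subtype.val '' L : Set ℂ)ᶜ ∈ 𝓝 z₀ := by
    refine hL'.isClosed.isOpen_compl.mem_nhds ?_
    rintro ⟨z, -, hz⟩
    exact z.2 hz
  obtain ⟨r, hr, hball⟩ := Metric.mem_nhds_iff.mp hz₀
  obtain ⟨n, hnr, hn⟩ : ∃ n, (∀ z ∈ K, f^[n] z ∈ Metric.ball z₀ r) ∧ 1 ≤ n :=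
    ((hK.eventually_all.mpr fun z hz => hlim z hz (Metric.ball_mem_nhds z₀ hr)).and
      (eventually_ge_atTop 1)).exists
  have hF (a : ℂ) (ha : a ∈ (hK.image f^[n]).toFinset) : ∃ z ∈ K, f^[n] z = a := by
    simpa using ha
  -- The correction `q` carries the defect `u - G` at the nodes `fⁿ(z)`. They lie in a ball about
  -- `z₀` missing `L`, hence nearer to `z₀` than `L`; injectivity of `fⁿ` on `K` makes the
  -- prescription consistent.
  obtain ⟨q, hq, hqF, hqL⟩ := exists_interpolation_small hL' (hK.image f^[n]).toFinset
    (z₀ := z₀) (fun a ha => by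
      obtain ⟨z, hz, rfl⟩ := hF a ha
      exact hne z hz n)
    (fun a ha z hz => by
      obtain ⟨w, hw, rfl⟩ := hF a ha
      refine lt_of_lt_of_le (Metric.mem_ball.mp (hnr w hw)) (not_lt.mp fun h => ?_)
      exact hball (Metric.mem_ball.mpr h) hz)
    (fun a => u (Function.invFunOn f^[n] K a) - G a) hη
  have hsum : DifferentiableOn ℂ (fun z => G z + q z) {z₀}ᶜ := hG.add hq
  refine ⟨n, hn, ⟨⟨fun z => G z + q z, hsum.continuousOn.domRestrict⟩, _, hsum, fun _ => rfl⟩,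
    hLO _ fun z hz => ?_, fun z hz h => ?_⟩
  · change dist (g₀.1 z) (G z + q z) < η
    rw [hgG, dist_self_add_right]
    exact hqL z (mem_image_of_mem _ hz)
  · change G (f^[n] z) + q (f^[n] z) = u z
    rw [hqF _ (by simpa using ⟨z, hz, rfl⟩), (hinj n).leftInvOn_invFunOn hz]
    ring

theorem mainTheorem7 (f : ℂ → ℂ) (z₀ : ℂ) (U V : Set ℂ) (φ : ℂ → ℂ)
    (hf : DifferentiableOn ℂ f U) (hfix : f z₀ = z₀) (hsuper : deriv f z₀ = 0)
    (hnonconst : ¬ ∀ᶠ z in 𝓝 z₀, f z = z₀)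
    (hφ : IsBottcherMap f z₀ U V φ)
    (δ : ℝ) (hδ : 0 < δ) (hδV : Metric.closedBall (0 : ℂ) δ ⊆ V) :
    ∀ᶠ K in residual (CompactsIn (bottcherBall U φ δ)),
      ∀ᶠ g in residual (HolFun ({z₀}ᶜ : Set ℂ)),
        IsFUniversal (interior (bottcherBall U φ δ) \ {z₀}) {z₀}ᶜ f
          (K.1 : Set ℂ) (univ : Set C((K.1 : Set ℂ), ℂ)) g := by
  have hAU : interior (bottcherBall U φ δ) \ {z₀} ⊆ U :=
    sdiff_subset.trans (interior_subset.trans inter_subset_left)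
  have hmaps := hφ.mapsTo_interior (δ := δ) hfix hsuper
  refine residual_isFUniversal_of_transitive isOpen_compl_singleton
    (isOpen_interior.sdiff isClosed_singleton) (fun z hz => hz.2) hmaps
    (hf.continuousOn.mono hAU) fun K₀ ε hε O hO hOne u => ?_
  obtain ⟨K, hKfin, hKA, hKinj, hKK₀⟩ := exists_finite_approx (fun z => ‖φ z‖) (K₀ := K₀.1) hε
    fun x hx => hφ.infinite_norm_image hfix hsuper hδ (K₀.2 hx) (half_pos hε)
  obtain ⟨n, hn, g, hg, hgu⟩ := HolFun.exists_mem_forall_iterate_eq hKfin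
    (fun z hz => hφ.tendsto_iterate hfix hsuper (hAU (hKA hz)))
    (fun z hz n => (hmaps.iterate n (hKA hz)).2)
    (hφ.iterate_inj_of_norm hsuper (hKA.trans hAU) hKinj) hO hOne u
  exact ⟨⟨K, hKA.trans (sdiff_subset.trans interior_subset)⟩, hKK₀, n, hn, g, hg, hKA, hgu⟩
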